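/- Consider a butterfly network with $N\ge 2$ users. User $n$ has a utility function $U_n:[0,\infty)\to[0,\infty)$ that is concave, strictly increasing, continuous, and differentiable on $(0,\infty)$. All users share a bottleneck link with price $p(q)=aq$ and cost $C(q)=\frac a2q^2$. Users $1$ and $N$ can perform inter-session network coding; users $2,\dots,N-1$ only route. The side link from the source of user $1$ to the receiver of user $N$ has price $p_1(v)=a_1v$ and cost $C_1(v)=\frac{a_1}2v^2$; the side link from the source of user $N$ to the receiver of user $1$ has price $p_N(v)=a_Nv$ and cost $C_N(v)=\frac{a_N}2v^2$. Here $a,a_1,a_N>0$. Every user $n$ chooses a rate $y_n\ge0$ of routed packets. For $k\in\{1,N\}$, user $k$ also chooses a rate $z_k\ge0$ of packets marked for network coding and a rate $v_k\ge0$ of remedy packets sent over the side link that starts at its source. The load of the bottleneck link is $q=\sum_{n=1}^Ny_n+\max(z_1,z_N)$. The received rates are $x_1=y_1+\min(z_1,v_N)$, $x_N=y_N+\min(z_N,v_1)$, and $x_n=y_n$ for $1<n<N$. The network aggregate surplus is $$\sum_{n=1}^NU_n(x_n)-C(q)-C_1(v_1)-C_N(v_N).$$ Fix a price discrimination parameter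 $\beta\in(0,1]$. In the resource allocation game, user $k\in\{1,N\}$ has the payoff $$U_k(x_k)-v_kp_k(v_k)-\bigl(y_k+z_k-(1-\beta)\min(z_1,z_N)\bigr)p(q)$$ and every other user $n$ has the payoff $U_n(y_n)-y_np(q)$. The efficiency of a Nash equilibrium is the ratio of its surplus to the maximal surplus over all non-negative rates, for the same parameters. The worst case of a class of systems is the infimum of the efficiencies of their Nash equilibria. The price of anarchy is the worst case of the class of all systems (all $N\ge2$, utilities and $a,a_1,a_N>0$). Theorem. For every $\beta\in(0,1]$: (a) The price of anarchy equals $\frac15$. (b) The worst case is approached as $N\to\infty$ and $a_1,a_N\to0$. That is: the worst case over all systems with exactly $N$ users is greater than $\frac15$ for every $N\ge 2$ and converges to $\frac15$ as $N\to\infty$; for every fixed $a>0$, the worst case over the systems with $N$ users and link parameters $a,a_1,a_N$ converges to $\frac15$ as $N\to\infty$ and $a_1,a_N\to0^+$ jointly; and for fixed $a,a_1,a_N>0$ the efficiencies of the Nash equilibria of all systems with these link parameters, with any number of users, are bounded below by a constant greater than $\frac15$. (c) At every Nash equilibrium $z_1=z_N=v_1=v_N=0$, that is, no network coding takes place. 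-/

import Mathlib

open Filter Topology Set

namespace Butterfly

/-- Admissible utility functions of a rate `x ≥ 0`: non-negative, (strictly) increasing, concave and
differentiable. At the end point `0` only continuity is required, so that utilities with infinite
slope at `0`, such as the `α`-fair ones `x ^ (1 - α) / (1 - α)` with `0 < α < 1`, are included. -/
structure IsUtility (U : ℝ → ℝ) : Prop where
  nonneg : ∀ x, 0 ≤ x → 0 ≤ U x
  strictMonoOn : StrictMonoOn U (Ici 0)
  concaveOn : ConcaveOn ℝ (Ici 0) U
  continuousOn : ContinuousOn U (Ici 0)
  differentiableOn : DifferentiableOn ℝ U (Ioi 0)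

/-- The linear price function `p(q) = a q` of a link. -/
def price (a q : ℝ) : ℝ := a * q

/-- The cost function of a link, `C(q) = ∫₀^q p(t) dt = (a / 2) q²`. -/
noncomputable def cost (a q : ℝ) : ℝ := a / 2 * q ^ 2

/-- The parameters of a butterfly network with `N = m + 2` users. User `0` is the first network
coding user ("user 1"), user `Fin.last (m + 1)` is the second one ("user N"), and the `m` users in
between are the routing users. The price parameters are `a` for the shared link, `a₁` for the side
link from the source of user 1 to the receiver of user N, and `aN` for the opposite side link. -/
structure System (m : ℕ) where
  U : Fin (m + 2) → ℝ → ℝ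
  a : ℝ
  a₁ : ℝ
  aN : ℝ
  isUtility : ∀ n, IsUtility (U n)
  a_pos : 0 < a
  a₁_pos : 0 < a₁
  aN_pos : 0 < aN

/-- A rate profile: `y n` is the rate of user `n` marked for routing, `z₁, zN` are the rates of the
two network coding users marked for network coding, `v₁, vN` their rates of remedy packets. -/
structure Rates (m : ℕ) where
  y : Fin (m + 2) → ℝ
  z₁ : ℝ
  zN : ℝ
  v₁ : ℝ
  vN : ℝ

/-- All rates are non-negative. -/
structure Rates.Feasible {m : ℕ} (r : Rates m) : Prop where
  y_nonneg : ∀ n, 0 ≤ r.y n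
  z₁_nonneg : 0 ≤ r.z₁
  zN_nonneg : 0 ≤ r.zN
  v₁_nonneg : 0 ≤ r.v₁
  vN_nonneg : 0 ≤ r.vN

/-- The total rate on the shared link. -/
noncomputable def Rates.load {m : ℕ} (r : Rates m) : ℝ :=
  ∑ n, r.y n + max r.z₁ r.zN

/-- The rate at which user `n` receives useful data. A network coding user can use a packet marked
for network coding only together with the remedy packets sent by the other one. -/
noncomputable def Rates.received {m : ℕ} (r : Rates m) (n : Fin (m + 2)) : ℝ :=
  if n = 0 then r.y n + min r.z₁ r.vN
  else if n = Fin.last (m + 1) then r.y n + min r.zN r.v₁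
  else r.y n

/-- The network aggregate surplus: total utility minus the cost of the three links. -/
noncomputable def System.surplus {m : ℕ} (s : System m) (r : Rates m) : ℝ :=
  ∑ n, s.U n (r.received n) - cost s.a r.load - cost s.a₁ r.v₁ - cost s.aN r.vN

/-- `r` is an optimal solution of the surplus maximization problem. -/
structure System.IsOptimal {m : ℕ} (s : System m) (r : Rates m) : Prop where
  feasible : r.Feasible
  isMax : ∀ r' : Rates m, r'.Feasible → s.surplus r' ≤ s.surplus r

/-- The payoff of user 1: utility, minus the payment for the remedy packets, minus the payment at
the shared link, where packets that are jointly encoded cost `β` times the price. -/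
noncomputable def System.payoff₁ {m : ℕ} (β : ℝ) (s : System m) (r : Rates m) : ℝ :=
  s.U 0 (r.received 0) - r.v₁ * price s.a₁ r.v₁
    - (r.y 0 + r.z₁ - (1 - β) * min r.z₁ r.zN) * price s.a r.load

/-- The payoff of user N. -/
noncomputable def System.payoffN {m : ℕ} (β : ℝ) (s : System m) (r : Rates m) : ℝ :=
  s.U (Fin.last (m + 1)) (r.received (Fin.last (m + 1))) - r.vN * price s.aN r.vN
    - (r.y (Fin.last (m + 1)) + r.zN - (1 - β) * min r.z₁ r.zN) * price s.a r.load

/-- The payoff of a routing user. -/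
noncomputable def System.payoffRouting {m : ℕ} (s : System m) (r : Rates m)
    (n : Fin (m + 2)) : ℝ :=
  s.U n (r.y n) - r.y n * price s.a r.load

/-- `r` is a (pure) Nash equilibrium of the resource allocation game with price discrimination
parameter `β`: no user gains by a unilateral change of its own strategy, which is `(y, z, v)` for
a network coding user and `y` for a routing user. -/
structure System.IsNash {m : ℕ} (β : ℝ) (s : System m) (r : Rates m) : Prop where
  feasible : r.Feasible
  user₁ : ∀ y z v : ℝ, 0 ≤ y → 0 ≤ z → 0 ≤ v →
    s.payoff₁ β { r with y := Function.update r.y 0 y, z₁ := z, v₁ := v } ≤ s.payoff₁ β r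
  userN : ∀ y z v : ℝ, 0 ≤ y → 0 ≤ z → 0 ≤ v →
    s.payoffN β { r with y := Function.update r.y (Fin.last (m + 1)) y, zN := z, vN := v }
      ≤ s.payoffN β r
  routing : ∀ n : Fin (m + 2), n ≠ 0 → n ≠ Fin.last (m + 1) → ∀ y : ℝ, 0 ≤ y →
    s.payoffRouting { r with y := Function.update r.y n y } n ≤ s.payoffRouting r n

/-- `e` is the efficiency of some Nash equilibrium of the system: the ratio of the surplus at the
equilibrium to the surplus at an optimal solution, for the same system. -/
def System.IsEfficiency {m : ℕ} (β : ℝ) (s : System m) (e : ℝ) : Prop :=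
  ∃ r o : Rates m, s.IsNash β r ∧ s.IsOptimal o ∧ e = s.surplus r / s.surplus o

/-- All efficiencies of Nash equilibria, over all numbers of users and all systems. -/
def efficiencies (β : ℝ) : Set ℝ :=
  {e | ∃ (m : ℕ) (s : System m), s.IsEfficiency β e}

/-- All efficiencies of Nash equilibria of systems with `N = m + 2` users. -/
def efficienciesOfUsers (β : ℝ) (m : ℕ) : Set ℝ :=
  {e | ∃ s : System m, s.IsEfficiency β e}

/-- All efficiencies of Nash equilibria of systems with `N = m + 2` users and given price
parameters of the three links. -/
def efficienciesOfPrices (β : ℝ) (m : ℕ) (a a₁ aN : ℝ) : Set ℝ :=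
  {e | ∃ s : System m, s.a = a ∧ s.a₁ = a₁ ∧ s.aN = aN ∧ s.IsEfficiency β e}

/-- `w` is the worst case (greatest lower bound) of a non-empty set of efficiencies. The price of
anarchy is the worst case of all efficiencies. -/
def IsWorstCase (E : Set ℝ) (w : ℝ) : Prop := E.Nonempty ∧ IsGLB E w

end Butterfly

namespace Butterfly

/-! Remedy packets pay only for the other coding user, so an equilibrium has none; coded packets are
then useless but still charged as `β > 0`. Only routing at rates `y n` remains, with load `q`, and
best responses make `a * (q + y n)` a supergradient of each utility (`System.IsNash.le_tangent`).
Replacing the utilities by these tangents removes the same non-negative excess from the equilibrium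
surplus and from an upper bound for the optimum, so linear utilities are the worst
(`System.IsNash.le_efficiency`).

Put `u = y 0 + y (Fin.last (m + 1))`. The linear equilibrium surplus is `a * (q² / 2 + ∑ y n²)`. A
coded packet serves both coding users but loads the shared link once, so the optimum is at most `a *
(2q + u)² / 2`. The ratio `1 / 5` follows from `q² / 2 + u² / 2 = (2q + u)² / 10 + (q - 2u)² / 10`
(`sq_le_linear_nash`). Equality would need equal coding rates, `u = q / 2`, infinitely dispersed
routing users and free side links. Quantifying the last two defects gives the strict bounds;
`worstRates` approaches equality. -/

/-! ### Sums over users and received rates. -/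

lemma sum_update {ι : Type*} [Fintype ι] [DecidableEq ι] (f : ι → ℝ) (i : ι) (b : ℝ) :
    ∑ n, Function.update f i b n = ∑ n, f n - f i + b := by
  rw [Finset.sum_update_of_mem (Finset.mem_univ i),
    ← Finset.add_sum_erase Finset.univ f (Finset.mem_univ i), Finset.sdiff_singleton_eq_erase]
  ring

lemma sum_ends {m : ℕ} (f : Fin (m + 2) → ℝ) :
    ∑ n, f n = f 0 + f (Fin.last (m + 1)) + ∑ i : Fin m, f i.castSucc.succ := by
  rw [Fin.sum_univ_succ, Fin.sum_univ_castSucc, Fin.succ_last]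
  ring

lemma received_zero {m : ℕ} (r : Rates m) : r.received 0 = r.y 0 + min r.z₁ r.vN := by
  simp [Rates.received]

lemma received_last {m : ℕ} (r : Rates m) :
    r.received (Fin.last (m + 1)) = r.y (Fin.last (m + 1)) + min r.zN r.v₁ := by
  simp [Rates.received]

lemma received_middle {m : ℕ} (r : Rates m) {n : Fin (m + 2)} (h : n ≠ 0)
    (h' : n ≠ Fin.last (m + 1)) : r.received n = r.y n := by
  simp [Rates.received, h, h']

lemma Rates.Feasible.received_nonneg {m : ℕ} {r : Rates m} (hr : r.Feasible) (n : Fin (m + 2)) :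
    0 ≤ r.received n := by
  have h := hr.y_nonneg n
  have h1 := le_min hr.z₁_nonneg hr.vN_nonneg
  have h2 := le_min hr.zN_nonneg hr.v₁_nonneg
  unfold Rates.received
  split_ifs <;> linarith

/-! ### Equilibria: absence of coding, supergradients, positive load. -/

/-- The remedy packets and then the packets marked for network coding are useless for the user
who sends them, so there are none at a Nash equilibrium. -/
theorem System.IsNash.no_coding {m : ℕ} {β : ℝ} (hβ : 0 < β) {s : System m} {r : Rates m}
    (h : s.IsNash β r) : r.z₁ = 0 ∧ r.zN = 0 ∧ r.v₁ = 0 ∧ r.vN = 0 := by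
  obtain ⟨hy, hz₁, hzN, hv₁, hvN⟩ := h.feasible
  have ha := s.a_pos
  have hq : 0 ≤ ∑ n, r.y n := Finset.sum_nonneg fun n _ => hy n
  have e1 : r.v₁ = 0 := by
    have h1 := h.user₁ (r.y 0) r.z₁ 0 (hy 0) hz₁ le_rfl
    simp only [System.payoff₁, received_zero, Rates.load, price, Function.update_eq_self] at h1
    have : s.a₁ * (r.v₁ * r.v₁) ≤ 0 := by linarith
    have : r.v₁ * r.v₁ ≤ 0 := nonpos_of_mul_nonpos_right this s.a₁_pos
    exact mul_self_eq_zero.1 (this.antisymm (mul_self_nonneg _))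
  have e2 : r.vN = 0 := by
    have h1 := h.userN (r.y (Fin.last (m + 1))) r.zN 0 (hy _) hzN le_rfl
    simp only [System.payoffN, received_last, Rates.load, price, Function.update_eq_self] at h1
    have : s.aN * (r.vN * r.vN) ≤ 0 := by linarith
    have : r.vN * r.vN ≤ 0 := nonpos_of_mul_nonpos_right this s.aN_pos
    exact mul_self_eq_zero.1 (this.antisymm (mul_self_nonneg _))
  -- Dropping `z` leaves the utility unchanged, so only payments are compared. The charged amount `z
  -- - (1 - β) * min z Z` is positive: it is `z` if the minimum vanishes, and at least `β * min z Z`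
  -- otherwise.
  have key : ∀ y z Z : ℝ, 0 ≤ y → 0 ≤ z → 0 ≤ Z →
      (y + z - (1 - β) * min z Z) * (s.a * (∑ n, r.y n + max z Z)) ≤
        y * (s.a * (∑ n, r.y n + Z)) → z = 0 := by
    intro y z Z h1 h2 h3 h4
    by_contra hne
    have hz : 0 < z := lt_of_le_of_ne h2 (Ne.symm hne)
    have hm : 0 < z - (1 - β) * min z Z := by
      rcases (le_min h2 h3).eq_or_lt with h | h
      · rw [← h]
        linarith
      · linarith [min_le_left z Z, mul_pos hβ h]
    have hM := le_max_left z Z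
    have hM' := le_max_right z Z
    have h5 : 0 < (z - (1 - β) * min z Z) * (s.a * (∑ n, r.y n + max z Z)) := by
      have : 0 < ∑ n, r.y n + max z Z := by linarith
      positivity
    have h6 : y * (s.a * (∑ n, r.y n + Z)) ≤ y * (s.a * (∑ n, r.y n + max z Z)) := by
      gcongr
    linarith
  refine ⟨?_, ?_, e1, e2⟩
  · have h1 := h.user₁ (r.y 0) 0 r.v₁ (hy 0) le_rfl hv₁
    simp only [System.payoff₁, received_zero, Rates.load, price, Function.update_eq_self, e2,
      min_eq_right hz₁, min_self, min_eq_left hzN, max_eq_right hzN] at h1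
    exact key (r.y 0) r.z₁ r.zN (hy 0) hz₁ hzN (by linarith)
  · have h1 := h.userN (r.y (Fin.last (m + 1))) 0 r.vN (hy _) le_rfl hvN
    simp only [System.payoffN, received_last, Rates.load, price, Function.update_eq_self, e1,
      min_eq_right hzN, min_self, min_eq_right hz₁, max_eq_left hz₁] at h1
    refine key (r.y (Fin.last (m + 1))) r.zN r.z₁ (hy _) hzN hz₁ ?_
    rw [min_comm, max_comm]
    linarith

/-- A best response to the load `p` of the other users gives a supergradient of the utility. -/
lemma le_tangent_of_best_response {U : ℝ → ℝ} (hU : ConcaveOn ℝ (Ici 0) U) {a p x : ℝ}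
    (ha : 0 < a) (hx : 0 ≤ x)
    (h : ∀ y, 0 ≤ y → U y - y * (a * (p + y)) ≤ U x - x * (a * (p + x))) {y : ℝ} (hy : 0 ≤ y) :
    U y ≤ U x + a * (p + 2 * x) * (y - x) := by
  by_contra! hlt
  set E := U y - U x - a * (p + 2 * x) * (y - x) with hE
  have hEpos : 0 < E := by linarith
  have hA : 0 ≤ a * (y - x) ^ 2 := by positivity
  -- Moving the fraction `t` from `x` to `y` gains at least `t * E` by concavity and loses `t² * a *
  -- (y - x)²` in the payment. This `t` is small enough for the gain to win. No derivative enters,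
  -- so `x = 0` is covered.
  set t := E / (E + a * (y - x) ^ 2) with ht
  have hden : 0 < E + a * (y - x) ^ 2 := by linarith
  have ht0 : 0 < t := by positivity
  have ht1 : t ≤ 1 := by rw [ht, div_le_one hden]; linarith
  have htE : t * (E + a * (y - x) ^ 2) = E := div_mul_cancel₀ _ hden.ne'
  have hc := hU.2 (x := x) (y := y) hx hy (sub_nonneg.2 ht1) ht0.le (by ring)
  simp only [smul_eq_mul] at hc
  have hz := h ((1 - t) * x + t * y)
    (add_nonneg (mul_nonneg (sub_nonneg.2 ht1) hx) (mul_nonneg ht0.le hy))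
  have h3 : t * E ≤ t * (t * (a * (y - x) ^ 2)) := by rw [hE]; nlinarith
  have h4 : E ≤ t * (a * (y - x) ^ 2) := le_of_mul_le_mul_left h3 ht0
  nlinarith [mul_pos ht0 hEpos]

theorem System.IsNash.load_eq {m : ℕ} {β : ℝ} (hβ : 0 < β) {s : System m} {r : Rates m}
    (h : s.IsNash β r) : r.load = ∑ n, r.y n := by
  obtain ⟨h1, h2, -, -⟩ := h.no_coding hβ
  simp [Rates.load, h1, h2]

theorem System.IsNash.received_eq {m : ℕ} {β : ℝ} (hβ : 0 < β) {s : System m} {r : Rates m}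
    (h : s.IsNash β r) (n : Fin (m + 2)) : r.received n = r.y n := by
  obtain ⟨h1, h2, h3, h4⟩ := h.no_coding hβ
  simp [Rates.received, h1, h2, h3, h4]

theorem System.IsNash.le_tangent {m : ℕ} {β : ℝ} (hβ : 0 < β) {s : System m} {r : Rates m}
    (h : s.IsNash β r) (n : Fin (m + 2)) {x : ℝ} (hx : 0 ≤ x) :
    s.U n x ≤ s.U n (r.y n) + s.a * (∑ i, r.y i + r.y n) * (x - r.y n) := by
  obtain ⟨h1, h2, h3, h4⟩ := h.no_coding hβ
  have key := le_tangent_of_best_response (s.isUtility n).concaveOn (p := ∑ i, r.y i - r.y n)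
    s.a_pos (h.feasible.y_nonneg n) ?_ hx
  · convert key using 3
    ring
  intro y hy
  have hload : ∑ i, r.y i - r.y n + r.y n = ∑ i, r.y i := by ring
  rw [hload]
  by_cases hn : n = 0
  · subst hn
    have := h.user₁ y 0 0 hy le_rfl le_rfl
    simp only [System.payoff₁, received_zero, Rates.load, price, sum_update, h1, h2, h3, h4,
      min_self, max_self, Function.update_self, add_zero, mul_zero, sub_zero] at this
    linarith
  by_cases hn' : n = Fin.last (m + 1)
  · subst hn'
    have := h.userN y 0 0 hy le_rfl le_rfl
    simp only [System.payoffN, received_last, Rates.load, price, sum_update, h1, h2, h3, h4,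
      min_self, max_self, Function.update_self, add_zero, mul_zero, sub_zero] at this
    linarith
  · have := h.routing n hn hn' y hy
    simp only [System.payoffRouting, Rates.load, price, sum_update, h1, h2,
      max_self, Function.update_self, add_zero] at this
    linarith

/-- At zero load the supergradient of user `0` at `0` would be `0`, against strict monotonicity. -/
theorem System.IsNash.load_pos {m : ℕ} {β : ℝ} (hβ : 0 < β) {s : System m} {r : Rates m}
    (h : s.IsNash β r) : 0 < ∑ n, r.y n := by
  have hy := h.feasible.y_nonneg
  refine lt_of_le_of_ne (Finset.sum_nonneg fun n _ => hy n) fun h0 => ?_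
  have hy0 : r.y 0 = 0 :=
    (Finset.sum_eq_zero_iff_of_nonneg fun n _ => hy n).1 h0.symm 0 (Finset.mem_univ _)
  have h1 := h.le_tangent hβ 0 zero_le_one
  rw [← h0, hy0] at h1
  have h2 := (s.isUtility 0).strictMonoOn (mem_Ici.2 le_rfl) (mem_Ici.2 zero_le_one) zero_lt_one
  linarith

/-! ### Comparison with the linearized utilities. -/

/-- The part of the utilities at `y` which their linearizations there miss. -/
noncomputable def System.excess {m : ℕ} (s : System m) (y : Fin (m + 2) → ℝ) : ℝ :=
  ∑ n, (s.U n (y n) - s.a * (∑ i, y i + y n) * y n)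

/-- Each summand is the value at `0` of a tangent line lying above `U 0 ≥ 0`. -/
theorem System.IsNash.excess_nonneg {m : ℕ} {β : ℝ} (hβ : 0 < β) {s : System m} {r : Rates m}
    (h : s.IsNash β r) : 0 ≤ s.excess r.y := by
  refine Finset.sum_nonneg fun n _ => ?_
  have h1 := h.le_tangent hβ n le_rfl
  have h2 := (s.isUtility n).nonneg 0 le_rfl
  linarith

theorem System.IsNash.surplus_eq {m : ℕ} {β : ℝ} (hβ : 0 < β) {s : System m} {r : Rates m}
    (h : s.IsNash β r) :
    s.surplus r = s.excess r.y + s.a * ((∑ n, r.y n) ^ 2 / 2 + ∑ n, r.y n ^ 2) := by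
  obtain ⟨h1, h2, h3, h4⟩ := h.no_coding hβ
  simp only [System.surplus, System.excess, h.received_eq hβ, h.load_eq hβ, h3, h4, cost,
    Finset.sum_sub_distrib]
  have : ∑ n, s.a * (∑ i, r.y i + r.y n) * r.y n
      = s.a * ((∑ n, r.y n) ^ 2 + ∑ n, r.y n ^ 2) := by
    rw [sq, Finset.sum_mul_sum, Finset.sum_comm, ← Finset.sum_add_distrib, Finset.mul_sum]
    refine Finset.sum_congr rfl fun n _ => ?_
    rw [← Finset.sum_mul]
    ring
  rw [this]
  ring

/-- The surplus of linear utilities, in terms of the total rate `K` of routed packets and the rate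
`W` of coded packets, when the slopes of the two coding users add up to `M`. -/
lemma linear_surplus_le {m : ℕ} {o : Rates m} (ho : o.Feasible) {α : Fin (m + 2) → ℝ}
    {M κ a a₁ aN b : ℝ} (hα : ∀ n, 0 ≤ α n) (hM : α 0 + α (Fin.last (m + 1)) = M)
    (hκ : ∀ n, α n ≤ κ * M) (ha : 0 ≤ a) (hb : 0 ≤ b) (hb₁ : b ≤ a₁) (hbN : b ≤ aN) :
    ∃ K W : ℝ, 0 ≤ K ∧ 0 ≤ W ∧
      ∑ n, α n * o.received n - cost a o.load - cost a₁ o.v₁ - cost aN o.vN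
        ≤ κ * M * K + M * W - a / 2 * (K + W) ^ 2 - b / 2 * W ^ 2 := by
  obtain ⟨hy, hz₁, hzN, hv₁, hvN⟩ := ho
  set w := min o.z₁ o.vN with hw
  set w' := min o.zN o.v₁ with hw'
  have hw0 : 0 ≤ w := le_min hz₁ hvN
  have hw'0 : 0 ≤ w' := le_min hzN hv₁
  have hK : 0 ≤ ∑ n, o.y n := Finset.sum_nonneg fun n _ => hy n
  have hW : 0 ≤ max w w' := le_max_of_le_left hw0
  refine ⟨∑ n, o.y n, max w w', hK, hW, ?_⟩
  have hsum : ∑ n, α n * o.received n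
      = ∑ n, α n * o.y n + α 0 * w + α (Fin.last (m + 1)) * w' := by
    rw [sum_ends, sum_ends fun n => α n * o.y n, received_zero, received_last]
    have : ∀ i : Fin m, o.received i.castSucc.succ = o.y i.castSucc.succ := fun i =>
      received_middle o (Fin.succ_ne_zero _) fun h => by
        rw [← Fin.succ_last, Fin.succ_inj] at h
        exact (Fin.castSucc_lt_last i).ne h
    simp only [this]
    ring
  have h1 : ∑ n, α n * o.y n ≤ κ * M * ∑ n, o.y n := by
    rw [Finset.mul_sum]
    exact Finset.sum_le_sum fun n _ => mul_le_mul_of_nonneg_right (hκ n) (hy n)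
  -- A coded packet is worth the sum `M` of both slopes.
  have h2 : α 0 * w + α (Fin.last (m + 1)) * w' ≤ M * max w w' := by
    rw [← hM, add_mul]
    exact add_le_add (mul_le_mul_of_nonneg_left (le_max_left _ _) (hα _))
      (mul_le_mul_of_nonneg_left (le_max_right _ _) (hα _))
  have h3 : a / 2 * (∑ n, o.y n + max w w') ^ 2 ≤ cost a o.load := by
    have : max w w' ≤ max o.z₁ o.zN := max_le_max (min_le_left _ _) (min_le_left _ _)
    unfold cost Rates.load
    gcongr
  -- Only the side link carrying the larger useful rate is kept, at the smaller price `b`.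
  have h4 : b / 2 * max w w' ^ 2 ≤ cost a₁ o.v₁ + cost aN o.vN := by
    have c1 : b / 2 * w' ^ 2 ≤ cost a₁ o.v₁ := by
      have : w' ≤ o.v₁ := min_le_right _ _
      have : 0 ≤ a₁ := hb.trans hb₁
      unfold cost
      gcongr
    have c2 : b / 2 * w ^ 2 ≤ cost aN o.vN := by
      have : w ≤ o.vN := min_le_right _ _
      have : 0 ≤ aN := hb.trans hbN
      unfold cost
      gcongr
    have c3 : 0 ≤ b / 2 * w' ^ 2 := by positivity
    have c4 : 0 ≤ b / 2 * w ^ 2 := by positivity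
    rcases max_choice w w' with h | h <;> rw [h] <;> linarith
  rw [hsum]
  linarith

/-- The surplus of any profile is at most the one for the linearization at a Nash equilibrium. -/
theorem System.IsNash.surplus_le {m : ℕ} {β : ℝ} (hβ : 0 < β) {s : System m} {r o : Rates m}
    (h : s.IsNash β r) (ho : o.Feasible) :
    s.surplus o ≤ s.excess r.y +
      (∑ n, s.a * (∑ i, r.y i + r.y n) * o.received n
        - cost s.a o.load - cost s.a₁ o.v₁ - cost s.aN o.vN) := by
  have : ∑ n, s.U n (o.received n) ≤ s.excess r.y
      + ∑ n, s.a * (∑ i, r.y i + r.y n) * o.received n := by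
    rw [System.excess, ← Finset.sum_add_distrib]
    refine Finset.sum_le_sum fun n _ => ?_
    have := h.le_tangent hβ n (ho.received_nonneg n)
    linarith
  unfold System.surplus
  linarith

theorem System.IsNash.surplus_pos {m : ℕ} {β : ℝ} (hβ : 0 < β) {s : System m} {r : Rates m}
    (h : s.IsNash β r) : 0 < s.surplus r := by
  rw [h.surplus_eq hβ]
  have h1 := h.load_pos hβ
  have h2 : 0 ≤ ∑ n, r.y n ^ 2 := Finset.sum_nonneg fun n _ => sq_nonneg _
  have h3 := h.excess_nonneg hβ
  have := s.a_pos
  positivity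

/-- Lower bounds for the efficiency can be checked on the linearized utilities. -/
theorem System.IsNash.le_efficiency {m : ℕ} {β : ℝ} (hβ : 0 < β) {s : System m} {r o : Rates m}
    (h : s.IsNash β r) (ho : s.IsOptimal o) {c X : ℝ} (hc0 : 0 ≤ c) (hc1 : c ≤ 1)
    (hX : ∑ n, s.a * (∑ i, r.y i + r.y n) * o.received n
        - cost s.a o.load - cost s.a₁ o.v₁ - cost s.aN o.vN ≤ X)
    (hcX : c * X ≤ s.a * ((∑ n, r.y n) ^ 2 / 2 + ∑ n, r.y n ^ 2)) :
    c ≤ s.surplus r / s.surplus o := by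
  have h1 := h.surplus_pos hβ
  have h2 := ho.isMax r h.feasible
  rw [le_div_iff₀ (h1.trans_le h2)]
  have h3 := h.surplus_le hβ ho.feasible
  have h4 := h.excess_nonneg hβ
  -- As `c ≤ 1`, the common excess can only raise the ratio.
  calc c * s.surplus o ≤ c * (s.excess r.y + X) := by gcongr; linarith
    _ = c * s.excess r.y + c * X := by ring
    _ ≤ 1 * s.excess r.y + s.a * ((∑ n, r.y n) ^ 2 / 2 + ∑ n, r.y n ^ 2) := by gcongr
    _ = s.surplus r := by rw [h.surplus_eq hβ, one_mul]

/-! ### Lower bounds for the efficiency. -/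

lemma add_ends_le {m : ℕ} {y : Fin (m + 2) → ℝ} (hy : ∀ n, 0 ≤ y n) :
    y 0 + y (Fin.last (m + 1)) ≤ ∑ n, y n := by
  rw [sum_ends]
  have : 0 ≤ ∑ i : Fin m, y i.castSucc.succ := Finset.sum_nonneg fun _ _ => hy _
  linarith

/-- The slopes of the two coding users at an equilibrium add up to at least any other slope. -/
lemma linear_surplus_le_sq {m : ℕ} {o : Rates m} (ho : o.Feasible) {y : Fin (m + 2) → ℝ}
    (hy : ∀ n, 0 ≤ y n) {a a₁ aN : ℝ} (ha : 0 < a) (ha₁ : 0 < a₁) (haN : 0 < aN) :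
    ∑ n, a * (∑ i, y i + y n) * o.received n - cost a o.load - cost a₁ o.v₁ - cost aN o.vN
      ≤ a * (2 * ∑ i, y i + (y 0 + y (Fin.last (m + 1)))) ^ 2 / 2 := by
  have hq : 0 ≤ ∑ i, y i := Finset.sum_nonneg fun n _ => hy n
  obtain ⟨K, W, hK, hW, h⟩ := linear_surplus_le ho (α := fun n => a * (∑ i, y i + y n))
    (M := a * (2 * ∑ i, y i + (y 0 + y (Fin.last (m + 1))))) (κ := 1) (a := a) (a₁ := a₁)
    (aN := aN) (b := 0) (fun n => mul_nonneg ha.le (add_nonneg hq (hy n))) (by ring)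
    (fun n => by
      have h1 : y n ≤ ∑ i, y i := Finset.single_le_sum (fun i _ => hy i) (Finset.mem_univ n)
      have h2 := hy 0
      have h3 := hy (Fin.last (m + 1))
      rw [one_mul]
      exact mul_le_mul_of_nonneg_left (by linarith) ha.le) ha.le le_rfl ha₁.le haN.le
  refine h.trans ?_
  set T := 2 * ∑ i, y i + (y 0 + y (Fin.last (m + 1)))
  -- With `κ = 1` and `b = 0` the bound depends on `K + W` only and peaks at `K + W = T`.
  nlinarith [mul_nonneg ha.le (sq_nonneg (K + W - T))]

/-- The bound `1 / 5` with the two terms that it neglects. -/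
lemma sq_le_linear_nash {m : ℕ} (y : Fin (m + 2) → ℝ) :
    (2 * ∑ i, y i + (y 0 + y (Fin.last (m + 1)))) ^ 2 / 10
        + (∑ i, y i - 2 * (y 0 + y (Fin.last (m + 1)))) ^ 2 / 10
        + (∑ i : Fin m, y i.castSucc.succ) ^ 2 / (m + 1)
      ≤ (∑ n, y n) ^ 2 / 2 + ∑ n, y n ^ 2 := by
  have hm : (0 : ℝ) < m + 1 := by positivity
  -- Cauchy–Schwarz; `m + 1` in place of `m` avoids division by zero for two users.
  have h1 : (∑ i : Fin m, y i.castSucc.succ) ^ 2 / (m + 1)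
      ≤ ∑ i : Fin m, y i.castSucc.succ ^ 2 := by
    have := sq_sum_le_card_mul_sum_sq (s := Finset.univ) (f := fun i : Fin m => y i.castSucc.succ)
    rw [Finset.card_univ, Fintype.card_fin] at this
    have h0 : 0 ≤ ∑ i : Fin m, y i.castSucc.succ ^ 2 := Finset.sum_nonneg fun _ _ => sq_nonneg _
    rw [div_le_iff₀ hm]
    linarith
  rw [sum_ends fun n => y n ^ 2]
  nlinarith [sq_nonneg (y 0 - y (Fin.last (m + 1)))]

theorem one_fifth_le_efficiency {m : ℕ} {β : ℝ} (hβ : 0 < β) {s : System m} {e : ℝ}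
    (he : s.IsEfficiency β e) : 1 / 5 + 1 / (90 * (m + 1)) ≤ e := by
  obtain ⟨r, o, h, ho, rfl⟩ := he
  have hy := h.feasible.y_nonneg
  have hm : (1 : ℝ) ≤ m + 1 := by linarith [Nat.cast_nonneg (α := ℝ) m]
  set t : ℝ := 1 / (m + 1) with ht
  have ht0 : 0 < t := by positivity
  have ht1 : t ≤ 1 := by rw [ht, div_le_one (by linarith)]; exact hm
  have hte : (1 : ℝ) / (90 * (m + 1)) = t / 90 := by rw [ht]; field_simp
  rw [hte]
  refine h.le_efficiency hβ ho (by positivity) (by linarith)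
    (linear_surplus_le_sq ho.feasible hy s.a_pos s.a₁_pos s.aN_pos) ?_
  have h1 := sq_le_linear_nash r.y
  have h2 := add_ends_le hy
  have h3 : 0 ≤ r.y 0 + r.y (Fin.last (m + 1)) := add_nonneg (hy _) (hy _)
  have h4 := sum_ends r.y
  have h5 := h.load_pos hβ
  rw [div_eq_mul_one_div _ ((m : ℝ) + 1), ← ht] at h1
  have h6 : ∑ i : Fin m, r.y i.castSucc.succ
      = ∑ n, r.y n - (r.y 0 + r.y (Fin.last (m + 1))) := by linarith
  rw [h6] at h1
  set q := ∑ n, r.y n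
  set u := r.y 0 + r.y (Fin.last (m + 1))
  have h7 : t * (q - 2 * u) ^ 2 ≤ (q - 2 * u) ^ 2 := by nlinarith [sq_nonneg (q - 2 * u)]
  have h8 : t * (2 * q + u) ^ 2 ≤ t * (9 * q ^ 2) := by gcongr; nlinarith
  -- The two neglected terms cannot both vanish, since `q = 2 * (q - u) - (q - 2 * u)`. Together
  -- with `2 * q + u ≤ 3 * q` this allows the constant `90`.
  have h9 : t * q ^ 2 ≤ t * (2 * (q - 2 * u) ^ 2 + 8 * (q - u) ^ 2) := by
    gcongr; nlinarith [sq_nonneg (3 * q - 4 * u)]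
  have h10 : 0 ≤ t * (q - u) ^ 2 := by positivity
  rw [show (1 / 5 + t / 90) * (s.a * (2 * q + u) ^ 2 / 2)
    = s.a * ((1 / 5 + t / 90) * (2 * q + u) ^ 2 / 2) by ring]
  exact mul_le_mul_of_nonneg_left (by linarith) s.a_pos.le

/-- If no single user values the shared link at more than `3 / 4` of what the coding users jointly
do, the cost `b / 2 * W ^ 2` of the side links is felt at the optimum. -/
lemma coding_surplus_le {K W T a b δ : ℝ} (hK : 0 ≤ K) (hT : 0 < T) (ha : 0 < a)
    (hδ : 0 < δ) (hδ' : δ ≤ 1 / 8) (hb : 16 * δ * a ≤ b) :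
    3 / 4 * (a * T) * K + a * T * W - a / 2 * (K + W) ^ 2 - b / 2 * W ^ 2
      ≤ (1 - δ) * (a * T ^ 2 / 2) := by
  have hbW : 16 * δ * a * W ^ 2 ≤ b * W ^ 2 := by gcongr
  -- This is the claim after completing the square and scaling by `2 / a`. One term suffices in each
  -- case: the second if `K ≥ T / 4`, the third if `W ≥ T / 4`, the square if both are smaller.
  have main : δ * T ^ 2 ≤ (K + W - T) ^ 2 + T * K / 2 + 16 * δ * W ^ 2 := by
    have p1 : 0 ≤ T * K / 2 := by positivity
    have p2 : 0 ≤ 16 * δ * W ^ 2 := by positivity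
    have p3 : δ * T ^ 2 ≤ 1 / 8 * T ^ 2 := by gcongr
    have p4 := sq_nonneg (K + W - T)
    rcases le_total (T / 4) K with hc | hc
    · have : T * (T / 4) ≤ T * K := by gcongr
      linarith
    rcases le_total (T / 4) W with hc' | hc'
    · have : 16 * δ * (T / 4) ^ 2 ≤ 16 * δ * W ^ 2 := by gcongr
      linarith
    · have : (T / 2) ^ 2 ≤ (T - K - W) ^ 2 := by
        apply pow_le_pow_left₀ <;> linarith
      linarith [sq_nonneg T]
  have := mul_le_mul_of_nonneg_left main ha.le
  linarith

theorem fixed_prices_le_efficiency {m : ℕ} {β : ℝ} (hβ : 0 < β) {s : System m} {e : ℝ}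
    (he : s.IsEfficiency β e) :
    1 / 5 * (1 + min (1 / 8) (min s.a₁ s.aN / (16 * s.a))) ≤ e := by
  obtain ⟨r, o, h, ho, rfl⟩ := he
  have hy := h.feasible.y_nonneg
  have ha := s.a_pos
  set b := min s.a₁ s.aN with hb
  have hb0 : 0 < b := lt_min s.a₁_pos s.aN_pos
  set δ := min (1 / 8) (b / (16 * s.a)) with hδ
  have hδ0 : 0 < δ := lt_min (by norm_num) (by positivity)
  have hδ1 : δ ≤ 1 / 8 := min_le_left _ _
  have hδ2 : 16 * δ * s.a ≤ b := by
    have : δ ≤ b / (16 * s.a) := min_le_right _ _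
    rw [le_div_iff₀ (by positivity)] at this
    linarith
  have h1 := sq_le_linear_nash r.y
  have h2 := add_ends_le hy
  have h3 : 0 ≤ r.y 0 + r.y (Fin.last (m + 1)) := add_nonneg (hy _) (hy _)
  have h4 := sum_ends r.y
  have h5 := h.load_pos hβ
  -- If no routing user exceeds half the load, every slope is at most `3 / 4` of the joint slope, so
  -- a near-optimal profile must code and pay for side links.
  by_cases hmid : ∀ i : Fin m, r.y i.castSucc.succ ≤ (∑ n, r.y n) / 2
  · have hκ : ∀ n, s.a * (∑ i, r.y i + r.y n)
        ≤ 3 / 4 * (s.a * (2 * ∑ i, r.y i + (r.y 0 + r.y (Fin.last (m + 1))))) := by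
      have : ∀ n, r.y n ≤ max (r.y 0 + r.y (Fin.last (m + 1))) ((∑ n, r.y n) / 2) := by
        intro n
        refine Fin.cases ?_ (fun j => ?_) n
        · exact le_max_of_le_left (by linarith [hy (Fin.last (m + 1))])
        · refine Fin.lastCases ?_ (fun i => ?_) j
          · rw [Fin.succ_last]
            exact le_max_of_le_left (by linarith [hy 0])
          · exact le_max_of_le_right (hmid i)
      intro n
      rw [mul_left_comm]
      gcongr
      rcases le_max_iff.1 (this n) with h | h <;> linarith
    obtain ⟨K, W, hK, hW, hL⟩ := linear_surplus_le ho.feasible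
      (α := fun n => s.a * (∑ i, r.y i + r.y n)) (κ := 3 / 4) (a := s.a) (a₁ := s.a₁)
      (aN := s.aN) (b := b) (fun n => mul_nonneg ha.le (add_nonneg h5.le (hy n)))
      (M := s.a * (2 * ∑ i, r.y i + (r.y 0 + r.y (Fin.last (m + 1))))) (by ring) hκ ha.le hb0.le
      (min_le_left _ _) (min_le_right _ _)
    have h6 : 0 ≤ (∑ i : Fin m, r.y i.castSucc.succ) ^ 2 / ((m : ℝ) + 1) := by positivity
    set T := 2 * ∑ i, r.y i + (r.y 0 + r.y (Fin.last (m + 1))) with hT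
    have hT0 : 0 < T := by linarith
    refine h.le_efficiency hβ ho (by positivity) (by linarith)
      (X := (1 - δ) * (s.a * T ^ 2 / 2)) (hL.trans ?_) ?_
    · exact coding_surplus_le hK hT0 ha hδ0 hδ1 hδ2
    · have : (1 + δ) * (1 - δ) ≤ 1 := by nlinarith
      calc 1 / 5 * (1 + δ) * ((1 - δ) * (s.a * T ^ 2 / 2))
          = (1 + δ) * (1 - δ) * (s.a * (T ^ 2 / 10)) := by ring
        _ ≤ 1 * (s.a * (T ^ 2 / 10)) := by gcongr
        _ ≤ _ := by
          rw [one_mul]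
          refine mul_le_mul_of_nonneg_left ?_ ha.le
          linarith [sq_nonneg (∑ i, r.y i - 2 * (r.y 0 + r.y (Fin.last (m + 1))))]
  -- A routing user above half the load forces `u ≤ q / 2` and `∑ y n² ≥ q² / 4`; the ratio then
  -- exceeds `1 / 5` without help from the side links.
  · push Not at hmid
    obtain ⟨i, hi⟩ := hmid
    refine h.le_efficiency hβ ho (by positivity) (by linarith)
      (linear_surplus_le_sq ho.feasible hy s.a_pos s.a₁_pos s.aN_pos) ?_
    have h6 : r.y i.castSucc.succ ≤ ∑ i : Fin m, r.y i.castSucc.succ :=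
      Finset.single_le_sum (f := fun i : Fin m => r.y i.castSucc.succ) (fun i _ => hy _)
        (Finset.mem_univ i)
    have h7 : r.y i.castSucc.succ ^ 2 ≤ ∑ n, r.y n ^ 2 :=
      Finset.single_le_sum (f := fun n => r.y n ^ 2) (fun i _ => sq_nonneg _)
        (Finset.mem_univ i.castSucc.succ)
    set q := ∑ n, r.y n
    set u := r.y 0 + r.y (Fin.last (m + 1))
    have h8 : (2 * q + u) ^ 2 ≤ (5 / 2 * q) ^ 2 := by
      apply pow_le_pow_left₀ <;> linarith
    have h9 : (q / 2) ^ 2 ≤ r.y i.castSucc.succ ^ 2 := by gcongr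
    calc 1 / 5 * (1 + δ) * (s.a * (2 * q + u) ^ 2 / 2)
        ≤ 1 / 5 * (1 + 1 / 8) * (s.a * (5 / 2 * q) ^ 2 / 2) := by gcongr
      _ = s.a * (225 / 320 * q ^ 2) := by ring
      _ ≤ _ := mul_le_mul_of_nonneg_left (by linarith [sq_nonneg q]) ha.le


/-! ### Existence of optima for linear utilities. -/

lemma isUtility_linear {c : ℝ} (hc : 0 < c) : IsUtility fun x => c * x where
  nonneg x hx := mul_nonneg hc.le hx
  strictMonoOn := fun _ _ _ _ h => mul_lt_mul_of_pos_left h hc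
  concaveOn := ((LinearMap.mulLeft ℝ c).concaveOn (convex_Ici 0))
  continuousOn := by fun_prop
  differentiableOn := by fun_prop

lemma Rates.Feasible.le_load {m : ℕ} {r : Rates m} (hr : r.Feasible) :
    (∀ n, r.y n ≤ r.load) ∧ (∀ n, r.received n ≤ r.load) ∧ r.z₁ ≤ r.load ∧ r.zN ≤ r.load := by
  obtain ⟨hy, hz₁, hzN, hv₁, hvN⟩ := hr
  have h1 : ∀ n, r.y n ≤ ∑ n, r.y n := fun n =>
    Finset.single_le_sum (fun i _ => hy i) (Finset.mem_univ n)
  have h2 : 0 ≤ ∑ n, r.y n := Finset.sum_nonneg fun n _ => hy n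
  have h3 := le_max_left r.z₁ r.zN
  have h4 := le_max_right r.z₁ r.zN
  unfold Rates.load
  refine ⟨fun n => by linarith [h1 n], fun n => ?_, by linarith, by linarith⟩
  have h5 := min_le_left r.z₁ r.vN
  have h6 := min_le_left r.zN r.v₁
  have h7 := h1 n
  unfold Rates.received
  split_ifs <;> linarith

/-- Rate profiles as points of a product of Euclidean spaces. -/
def Rates.ofProd {m : ℕ} (p : (Fin (m + 2) → ℝ) × ℝ × ℝ × ℝ × ℝ) : Rates m :=
  ⟨p.1, p.2.1, p.2.2.1, p.2.2.2.1, p.2.2.2.2⟩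

lemma continuous_received {m : ℕ} (n : Fin (m + 2)) :
    Continuous fun p => (Rates.ofProd (m := m) p).received n := by
  unfold Rates.received Rates.ofProd
  split_ifs <;> fun_prop

lemma continuous_load {m : ℕ} : Continuous fun p => (Rates.ofProd (m := m) p).load := by
  unfold Rates.load Rates.ofProd
  fun_prop

lemma System.continuous_surplus {m : ℕ} (s : System m) {α : Fin (m + 2) → ℝ}
    (hU : ∀ n x, s.U n x = α n * x) : Continuous fun p => s.surplus (Rates.ofProd p) := by
  have h1 := continuous_received (m := m)
  have h2 := continuous_load (m := m)
  have h3 : Continuous fun p => (Rates.ofProd (m := m) p).v₁ := by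
    unfold Rates.ofProd
    fun_prop
  have h4 : Continuous fun p => (Rates.ofProd (m := m) p).vN := by
    unfold Rates.ofProd
    fun_prop
  simp only [System.surplus, hU, cost]
  fun_prop

/-- Quadratic costs outgrow linear utilities, so the search for an optimum reduces to a compact box.
-/
lemma System.exists_bound {m : ℕ} (s : System m) {α : Fin (m + 2) → ℝ}
    (hα : ∀ n, 0 ≤ α n) (hU : ∀ n x, s.U n x = α n * x) :
    ∃ R : ℝ, 0 ≤ R ∧ ∀ r : Rates m, r.Feasible → 0 < s.surplus r →
      r.load ≤ R ∧ r.v₁ ≤ R ∧ r.vN ≤ R := by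
  have ha := s.a_pos
  have ha₁ := s.a₁_pos
  have haN := s.aN_pos
  set A := ∑ n, α n with hA
  have hA0 : 0 ≤ A := Finset.sum_nonneg fun n _ => hα n
  set R₁ := A ^ 2 / (s.a * s.a₁) with hR₁
  set RN := A ^ 2 / (s.a * s.aN) with hRN
  have hR₁0 : 0 ≤ R₁ := by positivity
  have hRN0 : 0 ≤ RN := by positivity
  have hRa0 : 0 ≤ 2 * A / s.a := by positivity
  set R := 2 * A / s.a + R₁ + RN + 1 with hR
  have hR0 : 0 ≤ R := by positivity
  refine ⟨R, hR0, fun r hr hpos => ?_⟩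
  obtain ⟨l1, l2, l3, l4⟩ := hr.le_load
  have hQ0 : 0 ≤ r.load := (hr.y_nonneg 0).trans (l1 0)
  have hlin : ∑ n, α n * r.received n ≤ A * r.load := by
    rw [hA, Finset.sum_mul]
    exact Finset.sum_le_sum fun n _ => mul_le_mul_of_nonneg_left (l2 n) (hα n)
  have hS : 0 < A * r.load - s.a / 2 * r.load ^ 2 - s.a₁ / 2 * r.v₁ ^ 2 - s.aN / 2 * r.vN ^ 2 := by
    simp only [System.surplus, hU, cost] at hpos
    linarith
  have k1 : 0 ≤ s.a₁ / 2 * r.v₁ ^ 2 := by positivity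
  have k2 : 0 ≤ s.aN / 2 * r.vN ^ 2 := by positivity
  have hQ : r.load ≤ R := by
    have : r.load ≤ 2 * A / s.a := by
      rw [le_div_iff₀ ha]
      by_contra! hlt
      have := mul_le_mul_of_nonneg_right hlt.le hQ0
      linarith
    linarith
  have hsq : A * r.load - s.a / 2 * r.load ^ 2 ≤ A ^ 2 / (2 * s.a) := by
    rw [le_div_iff₀ (by positivity)]
    linarith [sq_nonneg (s.a * r.load - A)]
  -- From `v² ≤ T` one gets `v ≤ T + 1`, hence the `+ 1` in `R`.
  have side : ∀ c v T : ℝ, 0 < c → T = A ^ 2 / (s.a * c) → T + 1 ≤ R →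
      c / 2 * v ^ 2 ≤ A ^ 2 / (2 * s.a) → v ≤ R := by
    intro c v T hc hT hTR hv
    have hv' : v ^ 2 ≤ T := by
      rw [hT, le_div_iff₀ (by positivity)]
      rw [le_div_iff₀ (by positivity)] at hv
      linarith
    by_contra! hlt
    have hT0 : 0 ≤ T := (sq_nonneg v).trans hv'
    nlinarith
  have hv₁ : r.v₁ ≤ R := side s.a₁ r.v₁ R₁ ha₁ rfl (by linarith) (by linarith)
  have hvN : r.vN ≤ R := side s.aN r.vN RN haN rfl (by linarith) (by linarith)
  exact ⟨hQ, hv₁, hvN⟩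

/-- Linear utilities admit an optimal profile. -/
theorem System.exists_isOptimal {m : ℕ} (s : System m) {α : Fin (m + 2) → ℝ}
    (hα : ∀ n, 0 ≤ α n) (hU : ∀ n x, s.U n x = α n * x) : ∃ o, s.IsOptimal o := by
  obtain ⟨R, hR0, hR⟩ := s.exists_bound hα hU
  have hB : IsCompact ((univ.pi fun _ : Fin (m + 2) => Icc (0 : ℝ) R) ×ˢ Icc (0 : ℝ) R ×ˢ
      Icc (0 : ℝ) R ×ˢ Icc (0 : ℝ) R ×ˢ Icc (0 : ℝ) R) :=
    (isCompact_univ_pi fun _ => isCompact_Icc).prod (isCompact_Icc.prod (isCompact_Icc.prod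
      (isCompact_Icc.prod isCompact_Icc)))
  set B := (univ.pi fun _ : Fin (m + 2) => Icc (0 : ℝ) R) ×ˢ Icc (0 : ℝ) R ×ˢ
      Icc (0 : ℝ) R ×ˢ Icc (0 : ℝ) R ×ˢ Icc (0 : ℝ) R with hBdef
  have hmem : ∀ {y z₁ zN v₁ vN}, (y, z₁, zN, v₁, vN) ∈ B ↔ (∀ n, 0 ≤ y n ∧ y n ≤ R) ∧
      (0 ≤ z₁ ∧ z₁ ≤ R) ∧ (0 ≤ zN ∧ zN ≤ R) ∧ (0 ≤ v₁ ∧ v₁ ≤ R) ∧ (0 ≤ vN ∧ vN ≤ R) := by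
    intro y z₁ zN v₁ vN
    simp only [hBdef, mem_prod, mem_univ_pi, mem_Icc]
  have h0mem : ((fun _ => 0, 0, 0, 0, 0) : (Fin (m + 2) → ℝ) × ℝ × ℝ × ℝ × ℝ) ∈ B :=
    hmem.2 ⟨fun _ => ⟨le_rfl, hR0⟩, ⟨le_rfl, hR0⟩, ⟨le_rfl, hR0⟩, ⟨le_rfl, hR0⟩, le_rfl, hR0⟩
  obtain ⟨⟨y, z₁, zN, v₁, vN⟩, hp, hmax⟩ :=
    hB.exists_isMaxOn ⟨_, h0mem⟩ (s.continuous_surplus hU).continuousOn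
  obtain ⟨q1, q2, q3, q4, q5⟩ := hmem.1 hp
  have hmax' : ∀ q ∈ B, s.surplus (Rates.ofProd q) ≤ s.surplus ⟨y, z₁, zN, v₁, vN⟩ :=
    fun q hq => hmax hq
  refine ⟨⟨y, z₁, zN, v₁, vN⟩, ⟨fun n => (q1 n).1, q2.1, q3.1, q4.1, q5.1⟩, fun r hr => ?_⟩
  -- Profiles without positive surplus are no better than the zero profile, which lies in the box.
  by_cases hpos : s.surplus r ≤ 0
  · have h0 := hmax' _ h0mem
    have h1 : s.surplus (Rates.ofProd (fun _ => 0, 0, 0, 0, 0)) = 0 := by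
      simp [System.surplus, hU, cost, Rates.load, Rates.ofProd, Rates.received]
    rw [h1] at h0
    exact hpos.trans h0
  obtain ⟨hQ, hv₁, hvN⟩ := hR r hr (not_le.1 hpos)
  obtain ⟨l1, -, l3, l4⟩ := hr.le_load
  exact hmax' (r.y, r.z₁, r.zN, r.v₁, r.vN) (hmem.2
    ⟨fun n => ⟨hr.y_nonneg n, (l1 n).trans hQ⟩, ⟨hr.z₁_nonneg, l3.trans hQ⟩,
      ⟨hr.zN_nonneg, l4.trans hQ⟩, ⟨hr.v₁_nonneg, hv₁⟩, hr.vN_nonneg, hvN⟩)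

/-! ### Linear systems with a prescribed equilibrium. -/

/-- The system with linear utilities for which routing at the rates `y` of sum `1` is a Nash
equilibrium. -/
def linearSystem {m : ℕ} (y : Fin (m + 2) → ℝ) (hy : ∀ n, 0 ≤ y n) {a a₁ aN : ℝ} (ha : 0 < a)
    (ha₁ : 0 < a₁) (haN : 0 < aN) : System m where
  U n x := a * (1 + y n) * x
  a := a
  a₁ := a₁
  aN := aN
  isUtility n := isUtility_linear (mul_pos ha (by linarith [hy n]))
  a_pos := ha
  a₁_pos := ha₁
  aN_pos := haN

/-- The profile at which the rates `y` are routed and there is no coding. -/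
def routingRates {m : ℕ} (y : Fin (m + 2) → ℝ) : Rates m := ⟨y, 0, 0, 0, 0⟩

/-- The other users load the link with `1 - x` and send no coded packets, so no discount applies.
The payoff is `a * x²` minus `a * (y - x)²` and non-negative terms in `z` and `v`. -/
lemma linear_best_response {a x y z v c : ℝ} (ha : 0 < a) (hc : 0 < c) (hx1 : x ≤ 1)
    (hy : 0 ≤ y) (hz : 0 ≤ z) :
    a * (1 + x) * y - v * (c * v) - (y + z) * (a * (1 - x + y + z))
      ≤ a * (1 + x) * x - x * a := by
  have h1 : 0 ≤ c * v ^ 2 := by positivity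
  have h2 : 0 ≤ a * (y - x) ^ 2 := by positivity
  have h3 : 0 ≤ a * (z * (1 - x + 2 * y + z)) :=
    mul_nonneg ha.le (mul_nonneg hz (by linarith))
  linarith

theorem isNash_linearSystem {m : ℕ} (β : ℝ) {y : Fin (m + 2) → ℝ} (hy : ∀ n, 0 ≤ y n)
    (hsum : ∑ n, y n = 1) {a a₁ aN : ℝ} (ha : 0 < a) (ha₁ : 0 < a₁) (haN : 0 < aN) :
    (linearSystem y hy ha ha₁ haN).IsNash β (routingRates y) := by
  have hy1 : ∀ n, y n ≤ 1 := fun n =>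
    hsum ▸ Finset.single_le_sum (fun i _ => hy i) (Finset.mem_univ n)
  refine ⟨⟨hy, le_rfl, le_rfl, le_rfl, le_rfl⟩, ?_, ?_, ?_⟩
  · intro x z v hx hz _
    have := linear_best_response (v := v) ha ha₁ (hy1 0) hx hz
    simp only [System.payoff₁, received_zero, Rates.load, price, sum_update, routingRates,
      linearSystem, Function.update_self, min_eq_right hz, max_eq_left hz, hsum, min_self,
      max_self]
    linarith
  · intro x z v hx hz _
    have := linear_best_response (v := v) ha haN (hy1 (Fin.last (m + 1))) hx hz
    simp only [System.payoffN, received_last, Rates.load, price, sum_update, routingRates,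
      linearSystem, Function.update_self, min_eq_right hz, min_eq_left hz, max_eq_right hz, hsum,
      min_self, max_self]
    linarith
  · intro n _ _ x hx
    have := linear_best_response (v := 0) ha ha (hy1 n) hx le_rfl
    simp only [System.payoffRouting, Rates.load, price, sum_update, routingRates,
      linearSystem, Function.update_self, hsum, max_self]
    linarith

lemma surplus_linearSystem {m : ℕ} {y : Fin (m + 2) → ℝ} (hy : ∀ n, 0 ≤ y n)
    (hsum : ∑ n, y n = 1) {a a₁ aN : ℝ} (ha : 0 < a) (ha₁ : 0 < a₁) (haN : 0 < aN) :
    (linearSystem y hy ha ha₁ haN).surplus (routingRates y) = a * (1 / 2 + ∑ n, y n ^ 2) := by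
  have hrec : ∀ n, (routingRates y).received n = y n := fun n => by
    simp [Rates.received, routingRates]
  have : ∀ n, a * (1 + y n) * y n = a * y n + a * y n ^ 2 := fun n => by ring
  simp only [System.surplus, hrec]
  simp only [linearSystem, cost, Rates.load, routingRates, hsum, this, Finset.sum_add_distrib,
    ← Finset.mul_sum, max_self]
  ring

theorem exists_efficiency_linearSystem {m : ℕ} (β : ℝ) {y : Fin (m + 2) → ℝ} (hy : ∀ n, 0 ≤ y n)
    (hsum : ∑ n, y n = 1) {a a₁ aN : ℝ} (ha : 0 < a) (ha₁ : 0 < a₁) (haN : 0 < aN) :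
    ∃ o, (linearSystem y hy ha ha₁ haN).IsOptimal o ∧
      a * (1 / 2 + ∑ n, y n ^ 2) / (linearSystem y hy ha ha₁ haN).surplus o
        ∈ efficienciesOfPrices β m a a₁ aN := by
  obtain ⟨o, ho⟩ := (linearSystem y hy ha ha₁ haN).exists_isOptimal
    (α := fun n => a * (1 + y n)) (fun n => mul_nonneg ha.le (by linarith [hy n]))
    (fun n x => rfl)
  refine ⟨o, ho, linearSystem y hy ha ha₁ haN, rfl, rfl, rfl, routingRates y, o,
    isNash_linearSystem β hy hsum ha ha₁ haN, ho, ?_⟩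
  rw [surplus_linearSystem hy hsum]

theorem efficienciesOfPrices_nonempty (β : ℝ) (m : ℕ) {a a₁ aN : ℝ} (ha : 0 < a) (ha₁ : 0 < a₁)
    (haN : 0 < aN) : (efficienciesOfPrices β m a a₁ aN).Nonempty := by
  obtain ⟨o, -, h⟩ := exists_efficiency_linearSystem β
    (y := fun _ : Fin (m + 2) => 1 / ((m : ℝ) + 2)) (fun _ => by positivity)
    (by simp; field_simp) ha ha₁ haN
  exact ⟨_, h⟩

/-! ### The extremal family. -/

/-- The rates `1 / 4` of the two coding users and `1 / (2 m)` of the others. -/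
noncomputable def worstRates (m : ℕ) (n : Fin (m + 2)) : ℝ :=
  if n = 0 ∨ n = Fin.last (m + 1) then 1 / 4 else 1 / (2 * m)

lemma worstRates_zero (m : ℕ) : worstRates m 0 = 1 / 4 := by simp [worstRates]

lemma worstRates_last (m : ℕ) : worstRates m (Fin.last (m + 1)) = 1 / 4 := by simp [worstRates]

lemma worstRates_middle {m : ℕ} (i : Fin m) : worstRates m i.castSucc.succ = 1 / (2 * m) := by
  have : i.castSucc.succ ≠ Fin.last (m + 1) := fun h => by
    rw [← Fin.succ_last, Fin.succ_inj] at h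
    exact (Fin.castSucc_lt_last i).ne h
  simp [worstRates, this, Fin.succ_ne_zero]

/-- These rates have `u = q / 2`, equal coding rates and evenly spread routing rates: equality up to
`∑ y n²` over the routing users. With `m = 0` they would not sum to `1`. -/
theorem exists_efficiency_le (β : ℝ) {m : ℕ} (hm : 0 < m) {a a₁ aN : ℝ} (ha : 0 < a)
    (ha₁ : 0 < a₁) (haN : 0 < aN) (hlt : a₁ + aN < a) :
    ∃ e ∈ efficienciesOfPrices β m a a₁ aN,
      e ≤ a * (5 / 8 + 1 / (4 * (m : ℝ))) / (25 / 8 * (a - (a₁ + aN))) := by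
  have hm' : (0 : ℝ) < m := by exact_mod_cast hm
  have hy : ∀ n, 0 ≤ worstRates m n := fun n => by
    unfold worstRates
    split_ifs <;> positivity
  have hsum : ∑ n, worstRates m n = 1 := by
    rw [sum_ends, worstRates_zero, worstRates_last]
    simp only [worstRates_middle, Finset.sum_const, Finset.card_univ, Fintype.card_fin,
      nsmul_eq_mul]
    field_simp
    norm_num
  have hsq : ∑ n, worstRates m n ^ 2 = 1 / 8 + 1 / (4 * m) := by
    rw [sum_ends, worstRates_zero, worstRates_last]
    simp only [worstRates_middle, Finset.sum_const, Finset.card_univ, Fintype.card_fin,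
      nsmul_eq_mul]
    field_simp
    ring
  obtain ⟨o, ho, h⟩ := exists_efficiency_linearSystem β hy hsum ha ha₁ haN
  refine ⟨_, h, ?_⟩
  have hle : 25 / 8 * (a - (a₁ + aN)) ≤ (linearSystem _ hy ha ha₁ haN).surplus o := by
    -- The coding slopes are `5 / 4 * a` each, so `5 / 2` is the optimal coded rate for free side
    -- links.
    have h1 := ho.isMax ⟨fun _ => 0, 5 / 2, 5 / 2, 5 / 2, 5 / 2⟩
      ⟨fun _ => le_rfl, by norm_num, by norm_num, by norm_num, by norm_num⟩
    refine le_trans (le_of_eq ?_) h1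
    rw [System.surplus, sum_ends, received_zero, received_last]
    have : ∀ i : Fin m, (⟨fun _ => 0, 5 / 2, 5 / 2, 5 / 2, 5 / 2⟩ : Rates m).received
        i.castSucc.succ = 0 := fun i =>
      received_middle _ (Fin.succ_ne_zero _) fun h => by
        rw [← Fin.succ_last, Fin.succ_inj] at h
        exact (Fin.castSucc_lt_last i).ne h
    simp only [this, linearSystem, worstRates_zero, worstRates_last, cost, Rates.load,
      Finset.sum_const_zero, mul_zero, min_self, max_self]
    ring
  rw [hsq, show (1 : ℝ) / 2 + (1 / 8 + 1 / (4 * m)) = 5 / 8 + 1 / (4 * m) by ring]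
  have : 0 < 25 / 8 * (a - (a₁ + aN)) := by linarith
  gcongr

lemma tendsto_efficiency_bound {a : ℝ} (ha : 0 < a) :
    Tendsto (fun t : ℕ × ℝ × ℝ =>
      a * (5 / 8 + 1 / (4 * (t.1 : ℝ))) / (25 / 8 * (a - (t.2.1 + t.2.2))))
      (atTop ×ˢ (𝓝[>] (0 : ℝ) ×ˢ 𝓝[>] (0 : ℝ))) (𝓝 (1 / 5)) := by
  have h1 : Tendsto (fun t : ℕ × ℝ × ℝ => 1 / (4 * (t.1 : ℝ)))
      (atTop ×ˢ (𝓝[>] (0 : ℝ) ×ˢ 𝓝[>] (0 : ℝ))) (𝓝 0) := by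
    have : Tendsto (fun n : ℕ => 1 / (4 * (n : ℝ))) atTop (𝓝 0) :=
      tendsto_const_nhds.div_atTop
        (tendsto_natCast_atTop_atTop.const_mul_atTop (by norm_num))
    exact this.comp tendsto_fst
  have h2 : Tendsto (fun t : ℕ × ℝ × ℝ => t.2.1)
      (atTop ×ˢ (𝓝[>] (0 : ℝ) ×ˢ 𝓝[>] (0 : ℝ))) (𝓝 0) :=
    (tendsto_fst.comp tendsto_snd).mono_right nhdsWithin_le_nhds
  have h3 : Tendsto (fun t : ℕ × ℝ × ℝ => t.2.2)
      (atTop ×ˢ (𝓝[>] (0 : ℝ) ×ˢ 𝓝[>] (0 : ℝ))) (𝓝 0) :=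
    (tendsto_snd.comp tendsto_snd).mono_right nhdsWithin_le_nhds
  have h4 := ((h1.const_add (5 / 8)).const_mul a).div
    (((h2.add h3).const_sub a).const_mul (25 / 8)) (by simpa using ha.ne')
  have hv : a * (5 / 8 + 0) / (25 / 8 * (a - (0 + 0))) = 1 / 5 := by
    rw [div_eq_div_iff (by simpa using ha.ne') (by norm_num)]
    ring
  rw [hv] at h4
  exact h4

/-! ### Limits of the worst cases. -/

lemma isWorstCase_sInf {E : Set ℝ} (hne : E.Nonempty) (h : ∀ e ∈ E, 1 / 5 ≤ e) :
    IsWorstCase E (sInf E) :=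
  ⟨hne, isGLB_csInf hne ⟨1 / 5, h⟩⟩

lemma efficienciesOfPrices_subset (β : ℝ) (m : ℕ) (a a₁ aN : ℝ) :
    efficienciesOfPrices β m a a₁ aN ⊆ efficienciesOfUsers β m :=
  fun _ ⟨s, _, _, _, h⟩ => ⟨s, h⟩

lemma one_fifth_le_of_mem_efficienciesOfUsers {β : ℝ} (hβ : 0 < β) {m : ℕ} {e : ℝ}
    (he : e ∈ efficienciesOfUsers β m) : 1 / 5 ≤ e := by
  obtain ⟨s, hs⟩ := he
  have : (0 : ℝ) ≤ 1 / (90 * (m + 1)) := by positivity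
  linarith [one_fifth_le_efficiency hβ hs]

theorem tendsto_sInf_efficienciesOfPrices {β : ℝ} (hβ : 0 < β) {a : ℝ} (ha : 0 < a) :
    Tendsto (fun t : ℕ × ℝ × ℝ => sInf (efficienciesOfPrices β t.1 a t.2.1 t.2.2))
      (atTop ×ˢ (𝓝[>] (0 : ℝ) ×ˢ 𝓝[>] (0 : ℝ))) (𝓝 (1 / 5)) := by
  have hlow : ∀ m a₁ aN, ∀ e ∈ efficienciesOfPrices β m a a₁ aN, 1 / 5 ≤ e := fun m a₁ aN e he =>
    one_fifth_le_of_mem_efficienciesOfUsers hβ (efficienciesOfPrices_subset β m a a₁ aN he)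
  -- The bound `a / 2` ensures `a₁ + aN < a`.
  have hpos : ∀ᶠ x : ℝ in 𝓝[>] 0, 0 < x ∧ x < a / 2 := by
    filter_upwards [Ioo_mem_nhdsGT (half_pos ha)] with x hx using hx
  have hev := (eventually_gt_atTop 0).prod_mk (hpos.prod_mk hpos)
  refine tendsto_of_tendsto_of_tendsto_of_le_of_le' tendsto_const_nhds
    (tendsto_efficiency_bound ha) ?_ ?_
  · filter_upwards [hev] with t ht
    exact le_csInf (efficienciesOfPrices_nonempty β t.1 ha ht.2.1.1 ht.2.2.1) (hlow _ _ _)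
  · filter_upwards [hev] with t ht
    obtain ⟨e, he, hle⟩ := exists_efficiency_le β ht.1 ha ht.2.1.1 ht.2.2.1
      (by linarith [ht.2.1.2, ht.2.2.2])
    exact (csInf_le ⟨1 / 5, hlow _ _ _⟩ he).trans hle

/-- Squeezed between `1 / 5` and the worst case along `a = 1`, `a₁ = aN = 1 / (m + 1)`. -/
theorem tendsto_sInf_efficienciesOfUsers {β : ℝ} (hβ : 0 < β) :
    Tendsto (fun m => sInf (efficienciesOfUsers β m)) atTop (𝓝 (1 / 5)) := by
  have hseq : Tendsto (fun n : ℕ => 1 / ((n : ℝ) + 1)) atTop (𝓝[>] 0) :=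
    tendsto_nhdsWithin_iff.2 ⟨tendsto_one_div_add_atTop_nhds_zero_nat,
      Eventually.of_forall fun n => by simp only [mem_Ioi]; positivity⟩
  refine tendsto_of_tendsto_of_tendsto_of_le_of_le tendsto_const_nhds
    ((tendsto_sInf_efficienciesOfPrices hβ one_pos).comp
      (tendsto_id.prodMk (hseq.prodMk hseq))) (fun m => ?_) (fun m => ?_)
  · exact le_csInf ((efficienciesOfPrices_nonempty β m one_pos one_pos one_pos).mono
      (efficienciesOfPrices_subset β m 1 1 1)) fun e he => one_fifth_le_of_mem_efficienciesOfUsers hβ he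
  · exact csInf_le_csInf ⟨1 / 5, fun e he => one_fifth_le_of_mem_efficienciesOfUsers hβ he⟩
      (efficienciesOfPrices_nonempty β m one_pos (by positivity) (by positivity))
      (efficienciesOfPrices_subset β m _ _ _)

end Butterfly

theorem theorem12 (β : ℝ) (hβ : 0 < β) (hβ' : β ≤ 1) :
    -- the price of anarchy is 1/5
    Butterfly.IsWorstCase (Butterfly.efficiencies β) (1 / 5) ∧
    -- for every finite number of users the worst case is better, and it tends to 1/5
    (∃ w : ℕ → ℝ,
      (∀ m, Butterfly.IsWorstCase (Butterfly.efficienciesOfUsers β m) (w m)) ∧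
      (∀ m, 1 / 5 < w m) ∧
      Tendsto w atTop (𝓝 (1 / 5))) ∧
    -- 1/5 is approached as the number of users grows and the side-link prices go to 0
    (∀ a : ℝ, 0 < a → ∃ w : ℕ → ℝ → ℝ → ℝ,
      (∀ m a₁ aN, 0 < a₁ → 0 < aN →
        Butterfly.IsWorstCase (Butterfly.efficienciesOfPrices β m a a₁ aN) (w m a₁ aN)) ∧
      Tendsto (fun t : ℕ × ℝ × ℝ => w t.1 t.2.1 t.2.2)
        (atTop ×ˢ (𝓝[>] (0 : ℝ) ×ˢ 𝓝[>] (0 : ℝ))) (𝓝 (1 / 5))) ∧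
    -- for fixed link prices, 1/5 is not approached, whatever the number of users
    (∀ a a₁ aN : ℝ, 0 < a → 0 < a₁ → 0 < aN →
      ∃ c : ℝ, 1 / 5 < c ∧
        ∀ m, ∀ e ∈ Butterfly.efficienciesOfPrices β m a a₁ aN, c ≤ e) ∧
    -- no network coding takes place at a Nash equilibrium
    (∀ (m : ℕ) (s : Butterfly.System m) (r : Butterfly.Rates m), s.IsNash β r →
      r.z₁ = 0 ∧ r.zN = 0 ∧ r.v₁ = 0 ∧ r.vN = 0) := by
  have hne : ∀ m, (Butterfly.efficienciesOfUsers β m).Nonempty := fun m =>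
    (Butterfly.efficienciesOfPrices_nonempty β m one_pos one_pos one_pos).mono
      (Butterfly.efficienciesOfPrices_subset β m 1 1 1)
  have hlow : ∀ m, ∀ e ∈ Butterfly.efficienciesOfUsers β m, 1 / 5 ≤ e := fun m e he =>
    Butterfly.one_fifth_le_of_mem_efficienciesOfUsers hβ he
  refine ⟨⟨?_, ?_, ?_⟩, ⟨fun m => sInf (Butterfly.efficienciesOfUsers β m), fun m =>
    Butterfly.isWorstCase_sInf (hne m) (hlow m), fun m => ?_,
    Butterfly.tendsto_sInf_efficienciesOfUsers hβ⟩, fun a ha =>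
    ⟨fun m a₁ aN => sInf (Butterfly.efficienciesOfPrices β m a a₁ aN), fun m a₁ aN ha₁ haN =>
      Butterfly.isWorstCase_sInf (Butterfly.efficienciesOfPrices_nonempty β m ha ha₁ haN)
        fun e he => hlow m e (Butterfly.efficienciesOfPrices_subset β m a a₁ aN he),
      Butterfly.tendsto_sInf_efficienciesOfPrices hβ ha⟩, fun a a₁ aN ha ha₁ haN =>
    ⟨1 / 5 * (1 + min (1 / 8) (min a₁ aN / (16 * a))), ?_, ?_⟩,
    fun m s r h => h.no_coding hβ⟩
  · obtain ⟨e, s, hs⟩ := hne 0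
    exact ⟨e, 0, s, hs⟩
  · rintro e ⟨m, s, hs⟩
    exact hlow m e ⟨s, hs⟩
  -- A common lower bound is below the worst case for each `m`, hence below their limit `1 / 5`.
  · intro b hb
    refine ge_of_tendsto' (Butterfly.tendsto_sInf_efficienciesOfUsers hβ) fun m => ?_
    exact le_csInf (hne m) fun e ⟨s, hs⟩ => hb ⟨m, s, hs⟩
  · have h1 : (0 : ℝ) < 1 / (90 * (m + 1)) := by positivity
    have h2 : 1 / 5 + 1 / (90 * ((m : ℝ) + 1)) ≤ sInf (Butterfly.efficienciesOfUsers β m) :=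
      le_csInf (hne m) fun e ⟨s, hs⟩ => Butterfly.one_fifth_le_efficiency hβ hs
    linarith
  · have : 0 < min (1 / 8) (min a₁ aN / (16 * a)) :=
      lt_min (by norm_num) (div_pos (lt_min ha₁ haN) (by positivity))
    linarith
  · rintro m e ⟨s, rfl, rfl, rfl, hs⟩
    exact Butterfly.fixed_prices_le_efficiency hβ hs
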